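/- All topological groups are Hausdorff. A topological group is called precompact if it is topologically isomorphic to a dense subgroup of a compact (Hausdorff) topological group. A topological space $X$ is called sequential if every subset of $X$ that contains the limits of all convergent sequences of its points is closed, and Fréchet if for every $A\subseteq X$ and every $x\in\overline{A}$ some sequence of points of $A$ converges to $x$. Let $G$ be a countable precompact topological group (not necessarily Abelian) whose topology is sequential. If $G$ has finite exponent, i.e. there is an integer $n\ge 1$ such that $g^n=1$ for every $g\in G$, then $G$ is Fréchet. In particular, if $G$ is boolean, i.e. $g\cdot g=1$ for every $g\in G$, then $G$ is Fréchet. -/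

import Mathlib

universe u

/-- A topological group `G` is precompact if it can be densely embedded as a subgroup of a
compact (Hausdorff) topological group: some group homomorphism from `G` to such a group is a
topological embedding with dense image. -/
def IsPrecompactGroup (G : Type u) [Group G] [TopologicalSpace G] : Prop :=
  ∃ (K : Type u) (_ : Group K) (_ : TopologicalSpace K),
    IsTopologicalGroup K ∧ CompactSpace K ∧ T2Space K ∧
      ∃ f : G →* K, IsDenseEmbedding f

open MeasureTheory Filter Topology
open scoped Pointwise

/-! Two facts combine. First, a compact group of finite exponent has a basis of open subgroups. Let
T be convolution with a symmetric bump φ. For g near 1, summing over the powers of g shows that g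
moves T^k φ by at most C δ^k. The elements with such a bound, C depending on the element, form an
open subgroup. As T is symmetric, the L² norms of T^k (gφ - φ) are log-convex, so
`le_mul_of_logConvex_of_le_geometric` removes C: the whole subgroup moves T φ little in L². An
element outside the given neighbourhood would make supports disjoint and move T φ too far.

Second, a countable sequential group with such a basis is Fréchet. Otherwise some y n → y₀ has every
y n, but not y₀, a limit of a sequence in a set A. Translation gives null sequences x n such that no
convergent sequence runs through rows n → ∞. With a Cauchy sequence d lacking convergent
subsequences, the elements (d n)⁻¹ * d k * x n k ≠ 1 with n ≤ k form a sequentially closed set with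
1 in its closure. -/

/-- A log-convex sequence dominated by a geometric one starts with a step of at most its ratio. -/
theorem le_mul_of_logConvex_of_le_geometric {p : ℕ → ℝ} (hp : ∀ k, 0 ≤ p k)
    (hlc : ∀ k, p (k + 1) ^ 2 ≤ p k * p (k + 2)) {C q : ℝ} (hq : 0 < q)
    (hb : ∀ k, p k ≤ C * q ^ k) : p 1 ≤ q * p 0 := by
  by_contra! h
  have h1 : 0 < p 1 := lt_of_le_of_lt (mul_nonneg hq.le (hp 0)) h
  have h0 : 0 < p 0 := by
    rcases (hp 0).eq_or_lt with h0 | h0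
    · have := hlc 0
      rw [← h0, zero_mul] at this
      nlinarith
    · exact h0
  set r := p 1 / p 0 with hr
  have hr0 : 0 < r := div_pos h1 h0
  have hqr : q < r := by rwa [hr, lt_div_iff₀ h0]
  have hstep : ∀ k, 0 < p k ∧ r * p k ≤ p (k + 1) := by
    intro k
    induction k with
    | zero => exact ⟨h0, by rw [hr, div_mul_cancel₀ _ h0.ne']⟩
    | succ k ih =>
      obtain ⟨hk, hk'⟩ := ih
      have hk1 : 0 < p (k + 1) := lt_of_lt_of_le (mul_pos hr0 hk) hk'
      refine ⟨hk1, ?_⟩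
      have h2 := hlc k
      have h3 : r * p k * p (k + 1) ≤ p k * p (k + 2) := by nlinarith
      have h4 : p k * (r * p (k + 1)) ≤ p k * p (k + 2) := by linarith
      exact le_of_mul_le_mul_left h4 hk
  have hgeo : ∀ k, p 0 * r ^ k ≤ p k := by
    intro k
    induction k with
    | zero => simp
    | succ k ih =>
      calc p 0 * r ^ (k + 1) = r * (p 0 * r ^ k) := by ring
        _ ≤ r * p k := by gcongr
        _ ≤ _ := (hstep k).2
  have hbd : ∀ k, (r / q) ^ k ≤ C / p 0 := by
    intro k
    rw [div_pow, div_le_div_iff₀ (pow_pos hq k) h0]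
    linarith [hgeo k, hb k]
  obtain ⟨k, hk⟩ := pow_unbounded_of_one_lt (C / p 0) ((one_lt_div hq).2 hqr)
  exact absurd (hbd k) (not_le.2 hk)

/-! ### L² estimates for continuous functions -/

section ContinuousMapIntegral

variable {X : Type*} [TopologicalSpace X] [CompactSpace X] [MeasurableSpace X]

theorem integral_sq_le (μ : Measure X) [IsProbabilityMeasure μ] (u : C(X, ℝ)) {c : ℝ} (h : ‖u‖ ≤ c) : ∫ x, u x ^ 2 ∂μ ≤ c ^ 2 := by
  have := norm_integral_le_of_norm_le_const (μ := μ) (f := fun x => u x ^ 2) (C := c ^ 2)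
    (ae_of_all _ fun x => by
      rw [norm_pow]; gcongr; exact (u.norm_coe_le_norm x).trans h)
  exact (le_abs_self _).trans (by simpa using this)

variable [BorelSpace X] (μ : Measure X)

theorem integrable_continuousMap [IsFiniteMeasure μ] (u : C(X, ℝ)) : Integrable u μ :=
  u.continuous.integrable_of_hasCompactSupport (HasCompactSupport.of_compactSpace _)

theorem sq_integral_mul_le [IsFiniteMeasure μ] (u v : C(X, ℝ)) :
    (∫ x, u x * v x ∂μ) ^ 2 ≤ (∫ x, u x ^ 2 ∂μ) * ∫ x, v x ^ 2 ∂μ := by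
  have h := real_inner_mul_inner_self_le (ContinuousMap.toLp 2 μ ℝ u) (ContinuousMap.toLp 2 μ ℝ v)
  simp only [ContinuousMap.inner_toLp, conj_trivial] at h
  simpa [sq, mul_comm] using h

theorem continuous_integral_continuousMap [IsProbabilityMeasure μ] : Continuous fun u : C(X, ℝ) => ∫ x, u x ∂μ := by
  refine (LipschitzWith.of_dist_le_mul (K := 1) fun u v => ?_).continuous
  rw [dist_eq_norm, dist_eq_norm,
    ← integral_sub (integrable_continuousMap μ u) (integrable_continuousMap μ v)]
  have := norm_integral_le_of_norm_le_const (μ := μ) (f := fun x => u x - v x) (C := ‖u - v‖)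
    (ae_of_all _ fun x => (u - v).norm_coe_le_norm x)
  simpa using this

theorem integral_sq_le_integral_sq_sub [IsFiniteMeasure μ] {u v : C(X, ℝ)}
    (h : ∀ x, u x * v x = 0) : ∫ x, v x ^ 2 ∂μ ≤ ∫ x, (u x - v x) ^ 2 ∂μ := by
  have hu : Integrable (fun x => (u x - v x) ^ 2) μ :=
    integrable_continuousMap μ ⟨fun x => (u x - v x) ^ 2, by fun_prop⟩
  have hv : Integrable (fun x => v x ^ 2) μ :=
    integrable_continuousMap μ ⟨fun x => v x ^ 2, by fun_prop⟩
  refine integral_mono hv hu fun x => ?_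
  have := h x
  dsimp only
  nlinarith [sq_nonneg (u x)]

end ContinuousMapIntegral

/-! ### Translations and convolution operators -/

section Convolution

variable {K : Type*} [Group K] [TopologicalSpace K] [IsTopologicalGroup K]

/-- Left translation of continuous functions on a topological group. -/
def leftTranslate (g : K) : C(K, ℝ) →ₗ[ℝ] C(K, ℝ) where
  toFun u := u.comp ⟨fun x => g⁻¹ * x, by fun_prop⟩
  map_add' _ _ := rfl
  map_smul' _ _ := rfl

@[simp] theorem leftTranslate_apply (g : K) (u : C(K, ℝ)) (x : K) :
    leftTranslate g u x = u (g⁻¹ * x) := rfl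

theorem leftTranslate_mul (g h : K) (u : C(K, ℝ)) :
    leftTranslate (g * h) u = leftTranslate g (leftTranslate h u) := by
  ext x; simp [mul_assoc]

@[simp] theorem leftTranslate_one (u : C(K, ℝ)) : leftTranslate (1 : K) u = u := by
  ext x; simp

theorem leftTranslate_iterate {T : C(K, ℝ) →ₗ[ℝ] C(K, ℝ)}
    (hT : ∀ g u, leftTranslate g (T u) = T (leftTranslate g u)) (g : K) (u : C(K, ℝ)) (k : ℕ) :
    leftTranslate g (T^[k] u) = T^[k] (leftTranslate g u) :=
  (Function.Commute.iterate_right (f := leftTranslate g) (g := T) (hT g) k).eq u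

variable [CompactSpace K]

theorem norm_leftTranslate_le (g : K) (u : C(K, ℝ)) : ‖leftTranslate g u‖ ≤ ‖u‖ :=
  (ContinuousMap.norm_le _ (norm_nonneg _)).2 fun _ => u.norm_coe_le_norm _

variable [MeasurableSpace K] [BorelSpace K] (μ : Measure K) [IsProbabilityMeasure μ]

/-- Right convolution by a continuous function, as an operator on continuous functions. -/
noncomputable def convolveRight (φ : C(K, ℝ)) : C(K, ℝ) →ₗ[ℝ] C(K, ℝ) where
  toFun u := ⟨fun x => ∫ y, u y * φ (y⁻¹ * x) ∂μ,
    (continuous_integral_continuousMap μ).comp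
      (ContinuousMap.curry (⟨fun p : K × K => u p.2 * φ (p.2⁻¹ * p.1), by fun_prop⟩ :
        C(K × K, ℝ))).continuous⟩
  map_add' u v := by
    ext x
    simp only [ContinuousMap.coe_mk, ContinuousMap.add_apply, add_mul]
    exact integral_add
      (integrable_continuousMap μ ⟨fun y => u y * φ (y⁻¹ * x), by fun_prop⟩)
      (integrable_continuousMap μ ⟨fun y => v y * φ (y⁻¹ * x), by fun_prop⟩)
  map_smul' c u := by
    ext x
    simp only [ContinuousMap.coe_mk, ContinuousMap.smul_apply, smul_eq_mul, mul_assoc,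
      RingHom.id_apply]
    exact integral_const_mul _ _

theorem convolveRight_apply (φ u : C(K, ℝ)) (x : K) :
    convolveRight μ φ u x = ∫ y, u y * φ (y⁻¹ * x) ∂μ := rfl

theorem leftTranslate_convolveRight [μ.IsMulLeftInvariant] (φ u : C(K, ℝ)) (g : K) :
    leftTranslate g (convolveRight μ φ u) = convolveRight μ φ (leftTranslate g u) := by
  ext x
  rw [leftTranslate_apply, convolveRight_apply, convolveRight_apply,
    ← integral_mul_left_eq_self (fun y => leftTranslate g u y * φ (y⁻¹ * x)) g]
  simp [mul_assoc]

/-- Fubini: the kernel φ (y⁻¹ * x) is symmetric in x and y. -/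
theorem integral_convolveRight_mul {φ : C(K, ℝ)} (hφ : ∀ x, φ x⁻¹ = φ x) (u v : C(K, ℝ)) :
    ∫ x, convolveRight μ φ u x * v x ∂μ = ∫ x, u x * convolveRight μ φ v x ∂μ := by
  simp only [convolveRight_apply, ← integral_mul_const, ← integral_const_mul]
  rw [integral_integral_swap_of_hasCompactSupport
    (by dsimp only [Function.uncurry_def]; fun_prop) (HasCompactSupport.of_compactSpace _)]
  refine integral_congr_ae (ae_of_all _ fun x => integral_congr_ae (ae_of_all _ fun y => ?_))
  have : φ (x⁻¹ * y) = φ (y⁻¹ * x) := by rw [← hφ]; simp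
  simp only [this]
  ring

/-- Translating convolutions by a small group element moves them little, uniformly. -/
theorem eventually_norm_leftTranslate_convolveRight_sub_le (φ : C(K, ℝ)) {δ : ℝ} (hδ : 0 < δ) :
    ∀ᶠ g in 𝓝 (1 : K), ∀ u : C(K, ℝ),
      ‖leftTranslate g (convolveRight μ φ u) - convolveRight μ φ u‖ ≤ δ * ‖u‖ := by
  let Φ : C(K, C(K × K, ℝ)) := ContinuousMap.curry
    ⟨fun p : K × (K × K) => φ (p.2.2⁻¹ * (p.1⁻¹ * p.2.1)), by fun_prop⟩
  have hΦ : ∀ᶠ g in 𝓝 (1 : K), dist (Φ g) (Φ 1) < δ :=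
    Φ.continuous.continuousAt.eventually (Metric.ball_mem_nhds _ hδ)
  filter_upwards [hΦ] with g hg u
  rw [dist_eq_norm] at hg
  refine (ContinuousMap.norm_le _ (by positivity)).2 fun x => ?_
  have hint : ∀ a, Integrable (fun y => u y * φ (y⁻¹ * a)) μ := fun a =>
    integrable_continuousMap μ ⟨fun y => u y * φ (y⁻¹ * a), by fun_prop⟩
  rw [ContinuousMap.sub_apply, leftTranslate_apply, convolveRight_apply, convolveRight_apply,
    ← integral_sub (hint _) (hint _)]
  have := norm_integral_le_of_norm_le_const (μ := μ)
    (f := fun y => u y * φ (y⁻¹ * (g⁻¹ * x)) - u y * φ (y⁻¹ * x)) (C := δ * ‖u‖)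
    (ae_of_all _ fun y => by
      rw [← mul_sub, norm_mul, mul_comm]
      gcongr
      · have h := (Φ g - Φ 1).norm_coe_le_norm (x, y)
        have h' : (Φ g - Φ 1) (x, y) = φ (y⁻¹ * (g⁻¹ * x)) - φ (y⁻¹ * x) := by
          simp [Φ, ContinuousMap.curry_apply]
        rw [h'] at h
        exact h.trans hg.le
      · exact u.norm_coe_le_norm y)
  simpa using this

end Convolution

/-! ### Open subgroups of compact groups of finite exponent -/

section FiniteExponent

variable {K : Type*} [Group K] [TopologicalSpace K] [IsTopologicalGroup K] [CompactSpace K]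

/-- The elements moving the iterates of an operator `T` on a function `φ` by at most a multiple of
`δ ^ k` form a subgroup. -/
def geometricallyMovingSubgroup (T : C(K, ℝ) →ₗ[ℝ] C(K, ℝ)) (φ : C(K, ℝ)) (δ : ℝ) :
    Subgroup K where
  carrier := {g | ∃ C : ℝ, ∀ k, ‖leftTranslate g (T^[k] φ) - T^[k] φ‖ ≤ C * δ ^ k}
  one_mem' := ⟨0, by simp⟩
  mul_mem' := by
    rintro g h ⟨C, hC⟩ ⟨D, hD⟩
    refine ⟨D + C, fun k => ?_⟩
    set u := T^[k] φ
    have h1 : leftTranslate (g * h) u - u =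
        leftTranslate g (leftTranslate h u - u) + (leftTranslate g u - u) := by
      rw [leftTranslate_mul, map_sub]; abel
    rw [h1, add_mul]
    exact (norm_add_le _ _).trans
      (add_le_add ((norm_leftTranslate_le _ _).trans (hD k)) (hC k))
  inv_mem' := by
    rintro g ⟨C, hC⟩
    refine ⟨C, fun k => ?_⟩
    set u := T^[k] φ
    have h1 : leftTranslate g⁻¹ u - u = -leftTranslate g⁻¹ (leftTranslate g u - u) := by
      rw [map_sub, ← leftTranslate_mul]; simp
    rw [h1, norm_neg]
    exact (norm_leftTranslate_le _ _).trans (hC k)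

/-- If all powers of an element of finite order nearly commute with the inclusion of the image
of `T`, the element moves the image of `T` geometrically little. -/
theorem norm_leftTranslate_sub_le_of_pow_eq_one {T : C(K, ℝ) →ₗ[ℝ] C(K, ℝ)}
    (hT : ∀ g u, leftTranslate g (T u) = T (leftTranslate g u)) {δ : ℝ} {n : ℕ} (hn : n ≠ 0)
    {g : K} (hg : g ^ n = 1)
    (hδ : ∀ i < n, ∀ u, ‖leftTranslate (g ^ i) (T u) - T u‖ ≤ δ * ‖u‖) (u : C(K, ℝ)) :
    ‖leftTranslate g (T u) - T u‖ ≤ δ * ‖leftTranslate g u - u‖ := by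
  set v := leftTranslate g u - u with hv
  have hw : leftTranslate g (T u) - T u = T v := by rw [hv, map_sub, hT]
  rw [hw]
  -- The sum telescopes to the translate by g ^ n minus the identity, which vanishes.
  have hsum : ∑ i ∈ Finset.range n, leftTranslate (g ^ i) (T v) = 0 := by
    have : ∀ i, leftTranslate (g ^ i) (T v) =
        leftTranslate (g ^ (i + 1)) (T u) - leftTranslate (g ^ i) (T u) := by
      intro i
      rw [← hw, map_sub, ← leftTranslate_mul, ← pow_succ]
    simp only [this]
    rw [Finset.sum_range_sub (fun i => leftTranslate (g ^ i) (T u)), hg]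
    simp
  have hn' : (n : ℝ) • T v = -∑ i ∈ Finset.range n, (leftTranslate (g ^ i) (T v) - T v) := by
    rw [Finset.sum_sub_distrib, hsum]
    simp [Nat.cast_smul_eq_nsmul]
  have h1 : (n : ℝ) * ‖T v‖ ≤ n * (δ * ‖v‖) := by
    calc (n : ℝ) * ‖T v‖ = ‖(n : ℝ) • T v‖ := by rw [norm_smul]; simp
      _ ≤ ∑ i ∈ Finset.range n, δ * ‖v‖ := by
        rw [hn', norm_neg]
        exact norm_sum_le_of_le _ fun i hi => hδ i (Finset.mem_range.1 hi) v
      _ = _ := by simp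
  exact le_of_mul_le_mul_left h1 (by positivity)

/-- Near 1 all powers g ^ i with i < n are small too, so each application of T gains a factor δ. -/
theorem isOpen_geometricallyMovingSubgroup {T : C(K, ℝ) →ₗ[ℝ] C(K, ℝ)}
    (hT : ∀ g u, leftTranslate g (T u) = T (leftTranslate g u)) (φ : C(K, ℝ)) {δ : ℝ}
    (hδ : 0 ≤ δ) (hsmall : ∀ᶠ g in 𝓝 (1 : K), ∀ u, ‖leftTranslate g (T u) - T u‖ ≤ δ * ‖u‖)
    {n : ℕ} (hn : n ≠ 0) (hK : ∀ g : K, g ^ n = 1) :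
    IsOpen (geometricallyMovingSubgroup T φ δ : Set K) := by
  refine Subgroup.isOpen_of_mem_nhds _ (g := 1) ?_
  have hpow : ∀ᶠ g in 𝓝 (1 : K), ∀ i ∈ Finset.range n, ∀ u,
      ‖leftTranslate (g ^ i) (T u) - T u‖ ≤ δ * ‖u‖ :=
    (Finset.eventually_all _).2 fun i _ => by
      have : Tendsto (fun g : K => g ^ i) (𝓝 1) (𝓝 1) := by
        simpa using (continuous_pow i).tendsto (1 : K)
      exact this.eventually hsmall
  filter_upwards [hpow] with g hg
  refine ⟨‖leftTranslate g φ - φ‖, fun k => ?_⟩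
  induction k with
  | zero => simp
  | succ k ih =>
    rw [Function.iterate_succ_apply']
    refine (norm_leftTranslate_sub_le_of_pow_eq_one hT hn (hK g)
      (fun i hi => hg i (Finset.mem_range.2 hi)) _).trans ?_
    calc δ * _ ≤ δ * (‖leftTranslate g φ - φ‖ * δ ^ k) := by gcongr
      _ = _ := by ring

/-- The subgroup of elements moving the iterates of a symmetric operator `T` geometrically little
consists of elements moving `T φ` little in the mean. -/
theorem integral_sq_sub_le_of_mem_geometricallyMovingSubgroup [MeasurableSpace K] [BorelSpace K]
    (μ : Measure K) [IsProbabilityMeasure μ] {T : C(K, ℝ) →ₗ[ℝ] C(K, ℝ)}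
    (hT : ∀ g u, leftTranslate g (T u) = T (leftTranslate g u))
    (hsymm : ∀ u v : C(K, ℝ), ∫ x, T u x * v x ∂μ = ∫ x, u x * T v x ∂μ) {φ : C(K, ℝ)} {δ : ℝ}
    (hδ : 0 < δ) {g : K} (hg : g ∈ geometricallyMovingSubgroup T φ δ) :
    ∫ x, (leftTranslate g (T φ) x - T φ x) ^ 2 ∂μ ≤ δ ^ 2 * (2 * ‖φ‖) ^ 2 := by
  obtain ⟨C, hC⟩ := hg
  set w := leftTranslate g φ - φ with hw
  have hiter : ∀ k, T^[k] w = leftTranslate g (T^[k] φ) - T^[k] φ := by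
    intro k
    rw [hw, leftTranslate_iterate hT]
    exact iterate_map_sub T k _ _
  have h := le_mul_of_logConvex_of_le_geometric (p := fun k => ∫ x, T^[k] w x ^ 2 ∂μ)
    (C := C ^ 2) (q := δ ^ 2) (fun k => integral_nonneg fun x => sq_nonneg _)
    (fun k => by
      -- Symmetry shifts one T across; Cauchy–Schwarz then gives log-convexity.
      have h1 : ∫ x, T^[k + 1] w x ^ 2 ∂μ = ∫ x, T^[k] w x * T^[k + 2] w x ∂μ := by
        rw [Function.iterate_succ_apply' _ (k + 1), ← hsymm]
        simp only [← Function.iterate_succ_apply' T, sq]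
      rw [h1]
      exact sq_integral_mul_le μ _ _)
    (by positivity)
    (fun k => by
      rw [← pow_mul, mul_comm 2 k, pow_mul, ← mul_pow]
      exact integral_sq_le μ _ ((hiter k).symm ▸ hC k))
  have h1 : ∀ x, T^[1] w x = leftTranslate g (T φ) x - T φ x := fun x => by rw [hiter]; rfl
  simp only [h1] at h
  refine h.trans ?_
  gcongr
  refine integral_sq_le μ _ ?_
  rw [Function.iterate_zero, id, hw, two_mul]
  exact (norm_sub_le _ _).trans (add_le_add_left (norm_leftTranslate_le _ _) _)

/-- A compact Hausdorff group of finite exponent has a basis of open subgroups. -/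
theorem exists_open_subgroup_subset_of_pow_eq_one [T2Space K] {n : ℕ} (hn : n ≠ 0)
    (hK : ∀ g : K, g ^ n = 1) {W : Set K} (hW : W ∈ 𝓝 1) :
    ∃ H : Subgroup K, IsOpen (H : Set K) ∧ (H : Set K) ⊆ W := by
  let _ : MeasurableSpace K := borel K
  have : BorelSpace K := ⟨rfl⟩
  let μ : Measure K := Measure.haarMeasure ⊤
  have : IsProbabilityMeasure μ := ⟨Measure.haarMeasure_self (K₀ := ⊤)⟩
  obtain ⟨W₁, hW₁o, hW₁1, hW₁⟩ := exists_open_nhds_one_mul_subset hW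
  obtain ⟨W₂, hW₂o, hW₂1, hW₂⟩ := exists_open_nhds_one_mul_subset
    (inter_mem (hW₁o.mem_nhds hW₁1) (inv_mem_nhds_one K (hW₁o.mem_nhds hW₁1)))
  obtain ⟨ψ, hψ1, hψ0, -, -⟩ := exists_continuous_one_zero_of_isCompact
    (isCompact_singleton (x := (1 : K))) hW₂o.isClosed_compl
    (Set.disjoint_singleton_left.2 fun h => h hW₂1)
  -- Multiplying by the reflection makes φ symmetric, hence T symmetric.
  let φ : C(K, ℝ) := ⟨fun x => ψ x * ψ x⁻¹, by fun_prop⟩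
  have hφx : ∀ x, φ x = ψ x * ψ x⁻¹ := fun _ => rfl
  have hφ1 : φ 1 = 1 := by simp [hφx, hψ1 rfl]
  have hφ0 : ∀ x, φ x ≠ 0 → x ∈ W₂ := by
    intro x hx
    by_contra h
    exact hx (by simp [hφx, hψ0 h])
  have hφs : ∀ x, φ x⁻¹ = φ x := fun x => by simp [hφx, mul_comm]
  let T := convolveRight μ φ
  have hT0 : ∀ x, T φ x ≠ 0 → x ∈ W₂ * W₂ := by
    intro x hx
    by_contra h
    refine hx ?_
    rw [convolveRight_apply, ← integral_zero K ℝ (μ := μ)]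
    congr 1 with y
    by_contra hy
    exact h ⟨y, hφ0 _ (left_ne_zero_of_mul hy), y⁻¹ * x, hφ0 _ (right_ne_zero_of_mul hy), by simp⟩
  have hT1 : 0 < T φ 1 := by
    rw [convolveRight_apply]
    refine Continuous.integral_pos_of_hasCompactSupport_nonneg_nonzero (x := 1) (by fun_prop)
      (HasCompactSupport.of_compactSpace _) (fun y => ?_) (by simp [hφ1])
    rw [mul_one, hφs]
    exact mul_self_nonneg _
  have hc : 0 < ∫ x, T φ x ^ 2 ∂μ :=
    Continuous.integral_pos_of_hasCompactSupport_nonneg_nonzero (x := 1) (by fun_prop)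
      (HasCompactSupport.of_compactSpace _) (fun y => sq_nonneg _) (pow_ne_zero 2 hT1.ne')
  set c := ∫ x, T φ x ^ 2 ∂μ with hcdef
  have hT : ∀ g u, leftTranslate g (T u) = T (leftTranslate g u) := fun g u =>
    leftTranslate_convolveRight μ φ u g
  obtain ⟨δ, hδ, hδc⟩ : ∃ δ : ℝ, 0 < δ ∧ δ ^ 2 * (2 * ‖φ‖) ^ 2 < c := by
    have hlim : Tendsto (fun δ : ℝ => δ ^ 2 * (2 * ‖φ‖) ^ 2) (𝓝[>] 0) (𝓝 0) := by
      have : Continuous fun δ : ℝ => δ ^ 2 * (2 * ‖φ‖) ^ 2 := by fun_prop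
      simpa using (this.tendsto 0).mono_left nhdsWithin_le_nhds
    obtain ⟨δ, h1, h2⟩ := ((hlim.eventually (gt_mem_nhds hc)).and self_mem_nhdsWithin).exists
    exact ⟨δ, h2, h1⟩
  refine ⟨geometricallyMovingSubgroup T φ δ, isOpen_geometricallyMovingSubgroup hT φ hδ.le
    (eventually_norm_leftTranslate_convolveRight_sub_le μ φ hδ) hn hK, fun g hg => ?_⟩
  by_contra hgW
  have h1 := integral_sq_sub_le_of_mem_geometricallyMovingSubgroup μ hT
    (integral_convolveRight_mul μ hφs) hδ hg
  have hdisj : ∀ x, leftTranslate g (T φ) x * T φ x = 0 := by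
    intro x
    by_contra hx
    rw [leftTranslate_apply] at hx
    have hx1 := hW₂ (hT0 _ (left_ne_zero_of_mul hx))
    have hx2 := hW₂ (hT0 _ (right_ne_zero_of_mul hx))
    refine hgW (hW₁ ⟨x, hx2.1, x⁻¹ * g, ?_, by simp⟩)
    simpa using hx1.2
  have h2 : c ≤ ∫ x, (leftTranslate g (T φ) x - T φ x) ^ 2 ∂μ :=
    integral_sq_le_integral_sq_sub μ hdisj
  linarith

end FiniteExponent

/-! ### Countable groups with a basis of open subgroups -/

section Nonarchimedean

variable {G : Type*} [Group G] [TopologicalSpace G]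

/-- In a countable Hausdorff group with a basis of open subgroups, a nontrivial null sequence
yields a Cauchy sequence none of whose subsequences converges. -/
theorem exists_cauchy_not_tendsto_of_null [IsTopologicalGroup G] [T2Space G] [Countable G]
    (hG : ∀ U ∈ 𝓝 (1 : G), ∃ H : Subgroup G, IsOpen (H : Set G) ∧ (H : Set G) ⊆ U)
    {z : ℕ → G} (hz : Tendsto z atTop (𝓝 1)) (hz1 : ∀ n, z n ≠ 1) :
    ∃ d : ℕ → G, (∀ U ∈ 𝓝 (1 : G), ∃ N, ∀ n ≥ N, ∀ k ≥ N, (d n)⁻¹ * d k ∈ U) ∧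
      ∀ (φ : ℕ → ℕ), Tendsto φ atTop atTop → ∀ g, ¬ Tendsto (d ∘ φ) atTop (𝓝 g) := by
  obtain ⟨e, he⟩ := exists_surjective_nat G
  -- Nested cosets: the new coset lies in the old one and misses `e k`, so no subsequence can
  -- converge to `e k`. The point moves, by some `z m`, only if it equals `e k`.
  have step : ∀ (k : ℕ) (s : G × {H : Subgroup G // IsOpen (H : Set G)}),
      ∃ t : G × {H : Subgroup G // IsOpen (H : Set G)},
        s.1⁻¹ * t.1 ∈ s.2.1 ∧ t.2.1 ≤ s.2.1 ∧ t.1⁻¹ * e k ∉ t.2.1 ∧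
          (t.1 = s.1 ∨ ∃ m ≥ k, t.1 = s.1 * z m) := by
    rintro k ⟨d, H, hH⟩
    obtain ⟨m, hmH, hmk⟩ := ((hz.eventually (hH.mem_nhds H.one_mem)).and
      (eventually_ge_atTop k)).exists
    have key : ∀ d' : G, d' ≠ e k → ∃ H' : {H : Subgroup G // IsOpen (H : Set G)},
        H'.1 ≤ H ∧ d'⁻¹ * e k ∉ H'.1 := by
      intro d' hd'
      have hne : (1 : G) ≠ d'⁻¹ * e k := by
        rw [Ne, eq_comm, inv_mul_eq_one]; exact hd'
      obtain ⟨H', hH', hsub⟩ := hG _ (inter_mem (hH.mem_nhds H.one_mem)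
        (isOpen_compl_singleton.mem_nhds hne : ({d'⁻¹ * e k}ᶜ : Set G) ∈ 𝓝 1))
      exact ⟨⟨H', hH'⟩, fun x hx => (hsub hx).1, fun hx => (hsub hx).2 rfl⟩
    by_cases hd : d = e k
    · have hd' : d * z m ≠ e k := by rw [← hd]; simpa using hz1 m
      obtain ⟨H', h1, h2⟩ := key _ hd'
      exact ⟨(d * z m, H'), by simpa using (show z m ∈ H from hmH), h1, h2, Or.inr ⟨m, hmk, rfl⟩⟩
    · obtain ⟨H', h1, h2⟩ := key _ hd
      exact ⟨(d, H'), by simp, h1, h2, Or.inl rfl⟩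
  choose next h1 h2 h3 h4 using step
  let s : ℕ → G × {H : Subgroup G // IsOpen (H : Set G)} := fun k =>
    Nat.rec (1, ⟨⊤, isOpen_univ⟩) next k
  have hs : ∀ k, s (k + 1) = next k (s k) := fun k => rfl
  have hanti : Antitone fun k => (s k).2.1 := antitone_nat_of_succ_le fun k => by
    rw [hs]; exact h2 k (s k)
  have htail : ∀ n k, n ≤ k → (s n).1⁻¹ * (s k).1 ∈ (s n).2.1 := by
    intro n k hnk
    induction k, hnk using Nat.le_induction with
    | base => simp
    | succ k hk ih =>
      have := hanti hk (h1 k (s k))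
      rw [← hs] at this
      simpa [mul_assoc] using mul_mem ih this
  refine ⟨fun k => (s k).1, fun U hU => ?_, fun φ hφ g hg => ?_⟩
  · obtain ⟨H, hH, hHU⟩ := hG U hU
    obtain ⟨N, hN⟩ := eventually_atTop.1 (hz.eventually (hH.mem_nhds H.one_mem))
    have hNk : ∀ k ≥ N, (s N).1⁻¹ * (s k).1 ∈ H := by
      intro k hk
      induction k, hk using Nat.le_induction with
      | base => simp
      | succ k hk ih =>
        rcases h4 k (s k) with h | ⟨m, hm, h⟩
        · rwa [hs, h]
        · rw [hs, h, ← mul_assoc]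
          exact mul_mem ih (hN m (le_trans hk hm))
    refine ⟨N, fun n hn k hk => hHU ?_⟩
    simpa [mul_assoc] using mul_mem (inv_mem (hNk n hn)) (hNk k hk)
  · obtain ⟨k, rfl⟩ := he g
    have hopen : IsOpen ((s (k + 1)).2.1 : Set G) := (s (k + 1)).2.2
    have hlim : Tendsto (fun i => (s (φ i)).1⁻¹ * e k) atTop (𝓝 1) := by
      simpa using (hg.inv).mul_const (e k)
    obtain ⟨i, hi, hik⟩ := ((hlim.eventually (hopen.mem_nhds (Subgroup.one_mem _))).and
      (hφ.eventually_ge_atTop (k + 1))).exists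
    have := mul_mem (htail (k + 1) (φ i) hik) hi
    rw [mul_assoc, mul_inv_cancel_left] at this
    rw [hs] at this
    exact h3 k (s k) this

/-- If a sequential space is not Fréchet, some set has a point in its second, but not in its first
sequential closure. -/
theorem exists_seqClosure_not_isSeqClosed {X : Type*} [TopologicalSpace X] [SequentialSpace X]
    (hX : ¬ FrechetUrysohnSpace X) : ∃ A : Set X, ¬ IsSeqClosed (seqClosure A) := by
  by_contra! h
  exact hX ⟨fun A => closure_minimal subset_seqClosure (h A).isClosed⟩

/-- A sequence of naturals is bounded along a constant subsequence or tends to infinity along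
a subsequence. -/
theorem exists_subseq_const_or_tendsto_atTop (n : ℕ → ℕ) :
    ∃ ψ : ℕ → ℕ, StrictMono ψ ∧ ((∃ c, ∀ i, n (ψ i) = c) ∨ Tendsto (n ∘ ψ) atTop atTop) := by
  by_cases h : Tendsto n atTop atTop
  · exact ⟨id, strictMono_id, Or.inr h⟩
  · obtain ⟨b, hb⟩ : ∃ b, ∃ᶠ i in atTop, n i < b := by
      simpa only [tendsto_atTop, not_forall, not_eventually, not_le] using h
    have : ∃ c, ∃ᶠ i in atTop, n i = c := by
      by_contra! hc
      have : ∀ᶠ i in atTop, ∀ c ∈ Finset.range b, n i ≠ c :=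
        (Finset.eventually_all _).2 fun c _ => by simpa [not_frequently] using hc c
      obtain ⟨i, hi, hi'⟩ := (hb.and_eventually this).exists
      exact hi' _ (Finset.mem_range.2 hi) rfl
    obtain ⟨c, hc⟩ := this
    obtain ⟨ψ, hψ, hψc⟩ := extraction_of_frequently_atTop hc
    exact ⟨ψ, hψ, Or.inl ⟨c, hψc⟩⟩

/-- A countable sequential Hausdorff group with a basis of open subgroups is Fréchet. -/
theorem frechetUrysohnSpace_of_openSubgroup_basis [IsTopologicalGroup G] [T2Space G] [Countable G]
    [SequentialSpace G]
    (hG : ∀ U ∈ 𝓝 (1 : G), ∃ H : Subgroup G, IsOpen (H : Set G) ∧ (H : Set G) ⊆ U) :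
    FrechetUrysohnSpace G := by
  by_contra hF
  obtain ⟨A, hA⟩ := exists_seqClosure_not_isSeqClosed hF
  simp only [IsSeqClosed, not_forall] at hA
  obtain ⟨y, y₀, hyA, hy, hy₀⟩ := hA
  choose s hsA hs using hyA
  have hyne : ∀ n, y₀⁻¹ * y n ≠ 1 := by
    intro n h
    rw [inv_mul_eq_one] at h
    exact hy₀ (h ▸ ⟨s n, hsA n, hs n⟩)
  obtain ⟨d, hdC, hdN⟩ := exists_cauchy_not_tendsto_of_null hG
    (z := fun n => y₀⁻¹ * y n) (by simpa using hy.const_mul y₀⁻¹) hyne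
  obtain ⟨e, he⟩ := exists_surjective_nat G
  have hV : ∀ g : G, ∃ V ∈ 𝓝 (1 : G), g ≠ 1 → Vᶜ ∈ 𝓝 g := by
    intro g
    by_cases hg : g = 1
    · exact ⟨Set.univ, univ_mem, fun h => absurd hg h⟩
    · obtain ⟨u, v, hu, hv, hgu, h1v, huv⟩ := t2_separation hg
      exact ⟨v, hv.mem_nhds h1v, fun _ =>
        mem_of_superset (hu.mem_nhds hgu) huv.subset_compl_right⟩
  choose V hV1 hVg using hV
  -- Row n is cut to lie in `V (e j)` for all j ≤ n, so a limit across rows n → ∞ can only be 1;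
  -- that limit would put `y₀` in `seqClosure A`.
  have hthin : ∀ n, ∃ M, ∀ m ≥ M, ∀ j ∈ Finset.range (n + 1),
      (y n)⁻¹ * s n m ∈ V (e j) := by
    intro n
    have hlim : Tendsto (fun m => (y n)⁻¹ * s n m) atTop (𝓝 1) := by
      simpa using (hs n).const_mul (y n)⁻¹
    exact eventually_atTop.1 ((Finset.eventually_all _).2 fun j _ =>
      hlim.eventually (hV1 (e j)))
  choose M hM using hthin
  let x : ℕ → ℕ → G := fun n k => (y n)⁻¹ * s n (k + M n)
  have hx : ∀ n, Tendsto (x n) atTop (𝓝 1) := fun n => by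
    have := ((hs n).comp (tendsto_add_atTop_nat (M n))).const_mul (y n)⁻¹
    simpa [x, Function.comp_def] using this
  have htrans : ∀ (n k : ℕ → ℕ) (g : G), Tendsto n atTop atTop →
      ¬ Tendsto (fun i => x (n i) (k i)) atTop (𝓝 g) := by
    intro n k g hn hlim
    by_cases hg : g = 1
    · refine hy₀ ⟨fun i => s (n i) (k i + M (n i)), fun i => hsA _ _, ?_⟩
      simpa [x, hg] using (hy.comp hn).mul hlim
    · obtain ⟨j, rfl⟩ := he g
      obtain ⟨i, hi, hji⟩ := ((hlim.eventually (hVg _ hg)).and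
        (hn.eventually_ge_atTop j)).exists
      exact hi (hM (n i) _ (Nat.le_add_left _ _) j (by simp; omega))
  let B : Set G := {a | a ≠ 1 ∧ ∃ n k, n ≤ k ∧ a = (d n)⁻¹ * d k * x n k}
  have hBclosed : IsSeqClosed B := by
    intro a g ha hag
    choose ha1 n k hle hnk using ha
    -- Constant n and k give a constant sequence; constant n with k → ∞ makes a subsequence of `d`
    -- converge; n → ∞ contradicts `htrans`, as the `d` factor tends to 1.
    obtain ⟨ψ, hψ, ⟨c, hc⟩ | hn⟩ := exists_subseq_const_or_tendsto_atTop n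
    · obtain ⟨χ, hχ, ⟨l, hl⟩ | hk⟩ := exists_subseq_const_or_tendsto_atTop (k ∘ ψ)
      · have hconst : ∀ i, a (ψ (χ i)) = (d c)⁻¹ * d l * x c l := by
          intro i
          have hl' := hl i
          simp only [Function.comp_apply] at hl'
          rw [hnk, hc, hl']
        have hg : Tendsto (fun i => a (ψ (χ i))) atTop (𝓝 g) :=
          hag.comp (hψ.comp hχ).tendsto_atTop
        have heq : g = a (ψ (χ 0)) := by
          simp only [hconst] at hg ⊢
          exact tendsto_nhds_unique hg tendsto_const_nhds
        rw [heq]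
        exact ⟨ha1 _, _, _, hle _, hnk _⟩
      · have hg : Tendsto (fun i => a (ψ (χ i))) atTop (𝓝 g) :=
          hag.comp (hψ.comp hχ).tendsto_atTop
        have hxc : Tendsto (fun i => x c (k (ψ (χ i)))) atTop (𝓝 1) := (hx c).comp hk
        refine absurd ?_ (hdN (fun i => k (ψ (χ i))) hk (d c * g))
        have := (hg.const_mul (d c)).mul hxc.inv
        simpa [hnk, hc, mul_assoc, Function.comp_def] using this
    · have hk : Tendsto (k ∘ ψ) atTop atTop := tendsto_atTop_mono (fun i => hle (ψ i)) hn
      have hd : Tendsto (fun i => (d (n (ψ i)))⁻¹ * d (k (ψ i))) atTop (𝓝 1) := by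
        intro U hU
        obtain ⟨N, hN⟩ := hdC U hU
        rw [mem_map]
        filter_upwards [hn.eventually_ge_atTop N, hk.eventually_ge_atTop N] with i h1 h2
        exact hN _ h1 _ h2
      refine absurd ?_ (htrans _ (k ∘ ψ) g hn)
      have := hd.inv.mul (hag.comp hψ.tendsto_atTop)
      simpa [hnk, mul_assoc, Function.comp_def] using this
  have h1B : (1 : G) ∈ closure B := by
    refine mem_closure_iff_nhds.2 fun U hU => ?_
    obtain ⟨W, hWo, hW1, hWU⟩ := exists_open_nhds_one_mul_subset hU
    obtain ⟨N, hN⟩ := hdC W (hWo.mem_nhds hW1)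
    -- Were the products eventually 1, `d k = d N * (x N k)⁻¹` would converge.
    have hfreq : ∃ᶠ k in atTop, (d N)⁻¹ * d k * x N k ≠ 1 := by
      intro hev
      refine hdN id tendsto_id (d N) ?_
      have hlim : Tendsto (fun k => d N * (x N k)⁻¹) atTop (𝓝 (d N)) := by
        simpa using ((hx N).inv).const_mul (d N)
      refine hlim.congr' ?_
      filter_upwards [hev] with k hk
      rw [not_not, mul_assoc, inv_mul_eq_one] at hk
      rw [hk, mul_inv_cancel_right, Function.comp_apply, id]
    obtain ⟨k, hk, hkW, hkN⟩ := (hfreq.and_eventually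
      (((hx N).eventually (hWo.mem_nhds hW1)).and (eventually_ge_atTop N))).exists
    exact ⟨_, hWU (Set.mul_mem_mul (hN N le_rfl k hkN) hkW), hk, N, k, hkN, rfl⟩
  rw [hBclosed.isClosed.closure_eq] at h1B
  exact h1B.1 rfl

end Nonarchimedean

/-! ### Passage to the compact group and conclusion -/

/-- A precompact group of finite exponent is Hausdorff and has a basis of open subgroups. -/
theorem IsPrecompactGroup.t2Space_and_openSubgroup_basis {G : Type*} [Group G]
    [TopologicalSpace G] (hG : IsPrecompactGroup G) (hexp : Monoid.ExponentExists G) :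
    T2Space G ∧
      ∀ U ∈ 𝓝 (1 : G), ∃ H : Subgroup G, IsOpen (H : Set G) ∧ (H : Set G) ⊆ U := by
  obtain ⟨K, _, _, _, _, _, f, hf⟩ := hG
  obtain ⟨n, hn, hGn⟩ := hexp
  have hK : ∀ k : K, k ^ n = 1 := fun k =>
    hf.dense.induction_on (p := fun k : K => k ^ n = 1) k
      (isClosed_eq (continuous_pow n) continuous_const)
      fun g => by rw [← map_pow, hGn, map_one]
  refine ⟨hf.isEmbedding.t2Space, fun U hU => ?_⟩
  rw [hf.isEmbedding.nhds_eq_comap, map_one] at hU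
  obtain ⟨W, hW, hWU⟩ := hU
  obtain ⟨H, hH, hHW⟩ := exists_open_subgroup_subset_of_pow_eq_one hn.ne' hK hW
  exact ⟨H.comap f, hH.preimage hf.continuous, fun g hg => hWU (hHW hg)⟩

theorem corollary2p6 (G : Type u) [Group G] [TopologicalSpace G] [IsTopologicalGroup G]
    [Countable G] [SequentialSpace G] (hG : IsPrecompactGroup G) :
    (Monoid.ExponentExists G → FrechetUrysohnSpace G) ∧
      ((∀ g : G, g * g = 1) → FrechetUrysohnSpace G) := by
  have key : Monoid.ExponentExists G → FrechetUrysohnSpace G := fun hexp => by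
    obtain ⟨_, hbasis⟩ := hG.t2Space_and_openSubgroup_basis hexp
    exact frechetUrysohnSpace_of_openSubgroup_basis hbasis
  exact ⟨key, fun h => key ⟨2, two_pos, fun g => by rw [sq, h]⟩⟩
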